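/- A right-preordered group is a (not necessarily abelian) group $X$, written additively, with a reflexive and transitive relation $\leq$ such that $x\leq y$ implies $x+z\leq y+z$ for all $x,y,z\in X$. Let $\mathbf{ROrdGrp}$ be the category of right-preordered groups and monotone group homomorphisms. Then: 1. $\mathbf{ROrdGrp}$ is a regular category: it has finite limits, every kernel pair has a coequalizer, and regular epimorphisms are stable under pullback. 2. $\mathbf{ROrdGrp}$ is a normal category: it is regular, it has a zero object, and every regular epimorphism is a normal epimorphism (a cokernel of some morphism). 3. $\mathbf{ROrdGrp}$ is efficiently regular: it is regular, and whenever $T\rightrightarrows X$ is an (internal) equivalence relation, $R\rightrightarrows X$ is an effective equivalence relation (that is, the kernel pair of some morphism), and $j\colon T\to R$ is a regular monomorphism compatible with the projections to $X$, then $T$ is also effective. 4. $\mathbf{ROrdGrp}$ is not (Barr) exact: not every equivalence relation in $\mathbf{ROrdGrp}$ is effective. -/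

import Mathlib

open CategoryTheory Limits

universe u v

/-- A right-preordered group: a (not necessarily commutative, additively written) group with a
preorder such that `x ≤ y` implies `x + z ≤ y + z`. -/
structure ROrdGrp : Type (u + 1) where
  /-- The underlying type. -/
  carrier : Type u
  [addGroup : AddGroup carrier]
  [preorder : Preorder carrier]
  [addRightMono : AddRightMono carrier]

namespace ROrdGrp

attribute [instance] ROrdGrp.addGroup ROrdGrp.preorder ROrdGrp.addRightMono

instance : CoeSort ROrdGrp.{u} (Type u) := ⟨ROrdGrp.carrier⟩

/-- The bundled right-preordered group on a type. -/
abbrev of (X : Type u) [AddGroup X] [Preorder X] [AddRightMono X] : ROrdGrp.{u} := ⟨X⟩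

/-- A morphism of right-preordered groups is a monotone group homomorphism. -/
@[ext]
structure Hom (X Y : ROrdGrp.{u}) where
  /-- The underlying monotone homomorphism. -/
  hom' : X →+o Y

instance : Category ROrdGrp.{u} where
  Hom X Y := Hom X Y
  id X := ⟨OrderAddMonoidHom.id X⟩
  comp f g := ⟨g.hom'.comp f.hom'⟩

instance : ConcreteCategory ROrdGrp.{u} (fun X Y => X →+o Y) where
  hom := Hom.hom'
  ofHom := Hom.mk

/-- A monotone group homomorphism as a morphism of `ROrdGrp`. -/
abbrev ofHom {X Y : Type u} [AddGroup X] [Preorder X] [AddRightMono X]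
    [AddGroup Y] [Preorder Y] [AddRightMono Y] (f : X →+o Y) : of X ⟶ of Y :=
  ConcreteCategory.ofHom (C := ROrdGrp.{u}) f

/-- The zero morphisms are the constant homomorphisms. -/
instance : HasZeroMorphisms ROrdGrp.{u} where
  zero _ _ := ⟨⟨0⟩⟩
  comp_zero _ _ := rfl
  zero_comp _ _ _ f := Hom.ext (OrderAddMonoidHom.ext fun _ => map_zero f.hom')

end ROrdGrp

/-- A normal category: a pointed regular category in which every regular epimorphism is a normal
epimorphism, that is, a cokernel. -/
class IsNormalCategory (C : Type u) [Category.{v} C] [HasZeroMorphisms C] : Prop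
    extends Regular C, HasZeroObject C where
  nonempty_normalEpi {X Y : C} (f : X ⟶ Y) : IsRegularEpi f → Nonempty (NormalEpi f)

/-- An efficiently regular category: a regular category in which every equivalence relation
`T ⇉ X` that is a subobject of an effective equivalence relation `R ⇉ X` (a kernel pair), through
a regular monomorphism `j : T ⟶ R` over `X`, is itself effective. -/
class IsEfficientlyRegular (C : Type u) [Category.{v} C] : Prop extends Regular C where
  isEffective {X T R : C} (t₁ t₂ : T ⟶ X) (r₁ r₂ : R ⟶ X) (j : T ⟶ R) :
    IsEquivalenceRelation t₁ t₂ → IsEffectiveEquivalenceRelation r₁ r₂ →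
    j ≫ r₁ = t₁ → j ≫ r₂ = t₂ → IsRegularMono j → IsEffectiveEquivalenceRelation t₁ t₂

/-- A (Barr) exact category: a regular category in which every equivalence relation is effective,
that is, a kernel pair. -/
class IsBarrExact (C : Type u) [Category.{v} C] : Prop extends Regular C where
  isEffective {X R : C} (r₁ r₂ : R ⟶ X) :
    IsEquivalenceRelation r₁ r₂ → IsEffectiveEquivalenceRelation r₁ r₂

namespace ROrdGrp

variable {X Y Z : ROrdGrp.{u}}

/-! The order is determined by the positive cone, so each claim is one about groups plus a check on
cones. Finite limits are those of groups with the induced order. Regular epimorphisms are exactly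
the surjections carrying the positive cone onto the positive cone (`isRegularEpi_iff`). Such maps
are cokernels of their kernels, and both kinds of lifting survive pullback.

As for groups, a reflexive relation is the congruence of a normal subgroup, the class of zero. It is
therefore the kernel pair of the quotient as soon as its order is induced from `X × X`
(`isKernelPair_of_reflexiveRelation`). Kernel pairs have the induced order and regular monomorphisms
reflect it, which gives efficient regularity. Exactness fails because a relation may carry a smaller
cone, such as the diagonal one on `ℤ × ℤ`. -/

@[simp]
lemma comp_hom'_apply (f : X ⟶ Y) (g : Y ⟶ Z) (x : X) :
    (f ≫ g).hom' x = g.hom' (f.hom' x) := rfl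

@[simp]
lemma zero_hom'_apply (x : X) : (0 : X ⟶ Y).hom' x = 0 := rfl

lemma hom_ext {f g : X ⟶ Y} (h : ∀ x, f.hom' x = g.hom' x) : f = g :=
  Hom.ext (OrderAddMonoidHom.ext h)

lemma hom'_congr {f g : X ⟶ Y} (h : f = g) (x : X) : f.hom' x = g.hom' x := by rw [h]

lemma monotone_hom' (f : X ⟶ Y) : Monotone f.hom' := f.hom'.monotone'

lemma hom'_nonneg (f : X ⟶ Y) {x : X} (hx : 0 ≤ x) : 0 ≤ f.hom' x := by
  simpa using monotone_hom' f hx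

/-- A homomorphism of groups preserving the positive cone is a morphism. -/
def homMk (f : X →+ Y) (hf : ∀ x, 0 ≤ x → 0 ≤ f x) : X ⟶ Y where
  hom' :=
    { toAddMonoidHom := f
      monotone' := fun x y h => by
        have := hf (y - x) (sub_nonneg.2 h)
        rw [map_sub] at this
        exact sub_nonneg.1 this }

/-! ### Subgroups with the induced order -/

section Subgroup

/-- A subgroup with the induced preorder. -/
def ofAddSubgroup (X : ROrdGrp.{u}) (S : AddSubgroup X) : ROrdGrp.{u} where
  carrier := S
  addRightMono := ⟨fun c _ _ h => add_le_add_left (α := X) h c.1⟩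

/-- The inclusion of a subgroup. -/
def subtype (X : ROrdGrp.{u}) (S : AddSubgroup X) : ofAddSubgroup X S ⟶ X where
  hom' := { toAddMonoidHom := S.subtype, monotone' := fun _ _ h => h }

/-- The corestriction of a morphism to a subgroup containing its image. -/
def codRestrict (f : Y ⟶ X) (S : AddSubgroup X) (h : ∀ y, f.hom' y ∈ S) :
    Y ⟶ ofAddSubgroup X S where
  hom' :=
    { toAddMonoidHom := (f.hom' : Y →+ X).codRestrict S h
      monotone' := fun _ _ hxy => monotone_hom' f hxy }

end Subgroup

/-! ### Finite limits -/

section Limits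

/-- The product of two right-preordered groups, ordered componentwise. -/
def prod (X Y : ROrdGrp.{u}) : ROrdGrp.{u} where
  carrier := X × Y
  addRightMono := ⟨fun c a b (h : a.1 ≤ b.1 ∧ a.2 ≤ b.2) =>
    Prod.mk_le_mk.2 ⟨add_le_add_left h.1 c.1, add_le_add_left h.2 c.2⟩⟩

/-- The first projection of a product. -/
def fst (X Y : ROrdGrp.{u}) : prod X Y ⟶ X where
  hom' := { toAddMonoidHom := AddMonoidHom.fst X Y, monotone' := fun _ _ h => h.1 }

/-- The second projection of a product. -/
def snd (X Y : ROrdGrp.{u}) : prod X Y ⟶ Y where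
  hom' := { toAddMonoidHom := AddMonoidHom.snd X Y, monotone' := fun _ _ h => h.2 }

/-- The morphism to a product with the given components. -/
def prodLift (a : Z ⟶ X) (b : Z ⟶ Y) : Z ⟶ prod X Y where
  hom' :=
    { toAddMonoidHom := (a.hom' : Z →+ X).prod (b.hom' : Z →+ Y)
      monotone' := fun _ _ h => ⟨monotone_hom' a h, monotone_hom' b h⟩ }

/-- The subgroup on which two morphisms agree. -/
def eqLocus (f g : X ⟶ Y) : AddSubgroup X :=
  (f.hom' : X →+ Y).eqLocus (g.hom' : X →+ Y)

lemma mem_eqLocus {f g : X ⟶ Y} {x : X} : x ∈ eqLocus f g ↔ f.hom' x = g.hom' x := Iff.rfl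

variable {B : ROrdGrp.{u}} (f : X ⟶ B) (g : Y ⟶ B)

/-- The fibre product of two morphisms. -/
def fibreProd : ROrdGrp.{u} :=
  ofAddSubgroup (prod X Y) (eqLocus (fst X Y ≫ f) (snd X Y ≫ g))

/-- The first projection of a fibre product. -/
def fibreFst : fibreProd f g ⟶ X := subtype _ _ ≫ fst X Y

/-- The second projection of a fibre product. -/
def fibreSnd : fibreProd f g ⟶ Y := subtype _ _ ≫ snd X Y

lemma isPullback_fibreProd : IsPullback (fibreFst f g) (fibreSnd f g) f g where
  w := hom_ext fun p => p.2
  isLimit' := ⟨PullbackCone.IsLimit.mk _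
    (fun s => codRestrict (prodLift s.fst s.snd) _
      (fun z => hom'_congr s.condition z))
    (fun _ => rfl) (fun _ => rfl)
    (fun _ _ h₁ h₂ => hom_ext fun z => Subtype.ext (Prod.ext
      (hom'_congr h₁ z) (hom'_congr h₂ z)))⟩

instance : HasPullbacks ROrdGrp.{u} :=
  have {X Y B : ROrdGrp.{u}} {f : X ⟶ B} {g : Y ⟶ B} : HasLimit (cospan f g) :=
    (isPullback_fibreProd f g).hasPullback
  hasPullbacks_of_hasLimit_cospan _

/-- The trivial group. -/
def trivialGroup : ROrdGrp.{u} where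
  carrier := PUnit
  addRightMono := ⟨fun _ _ _ _ => le_rfl⟩

lemma isZero_trivialGroup : IsZero trivialGroup.{u} where
  unique_to _ := ⟨⟨⟨0⟩, fun f => hom_ext fun _ => map_zero f.hom'⟩⟩
  unique_from _ := ⟨⟨⟨0⟩, fun _ => hom_ext fun _ => rfl⟩⟩

instance : HasZeroObject ROrdGrp.{u} := ⟨trivialGroup, isZero_trivialGroup⟩

instance : HasFiniteLimits ROrdGrp.{u} :=
  have : HasTerminal ROrdGrp.{u} := HasZeroObject.hasTerminal
  hasFiniteLimits_of_hasTerminal_and_pullbacks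

variable {f g}

/-- A compatible pair of elements is the image of an element of the pullback, which is nonnegative
if both elements of the pair are. -/
lemma exists_of_isPullback {P : ROrdGrp.{u}} {p : P ⟶ X} {q : P ⟶ Y} (h : IsPullback p q f g)
    {x : X} {y : Y} (hxy : f.hom' x = g.hom' y) :
    ∃ z : P, p.hom' z = x ∧ q.hom' z = y ∧ (0 ≤ x → 0 ≤ y → 0 ≤ z) := by
  -- Positivity holds in the concrete fibre product by construction; the monotone comparison map `e`
  -- transports it.
  let e := h.lift (fibreFst f g) (fibreSnd f g) (isPullback_fibreProd f g).w
  let w : fibreProd f g := ⟨(x, y), hxy⟩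
  refine ⟨e.hom' w, ?_, ?_, fun hx hy => hom'_nonneg e ⟨hx, hy⟩⟩
  · exact hom'_congr (h.lift_fst _ _ (isPullback_fibreProd f g).w) w
  · exact hom'_congr (h.lift_snd _ _ (isPullback_fibreProd f g).w) w

end Limits

/-- A jointly monic pair is jointly injective. -/
lemma eq_of_jointlyMono {R : ROrdGrp.{u}} {p : R ⟶ X} {q : R ⟶ Y} (h : JointlyMono₂ p q)
    {a b : R} (h₁ : p.hom' a = p.hom' b) (h₂ : q.hom' a = q.hom' b) : a = b := by
  -- Joint monicity is tested on the inclusion of the common kernel against zero.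
  let K : AddSubgroup R := eqLocus p 0 ⊓ eqLocus q 0
  have hK : subtype R K = 0 := h.right_cancellation _ _
    (hom_ext fun k => (mem_eqLocus.1 k.2.1).trans (map_zero p.hom').symm)
    (hom_ext fun k => (mem_eqLocus.1 k.2.2).trans (map_zero q.hom').symm)
  have hab : a - b ∈ K := ⟨by simp [mem_eqLocus, h₁], by simp [mem_eqLocus, h₂]⟩
  exact sub_eq_zero.1 (hom'_congr hK (⟨a - b, hab⟩ : K))

/-- The preorder of a kernel pair is induced by its projections. -/
lemma nonneg_of_isKernelPair {R : ROrdGrp.{u}} {p q : R ⟶ X} {f : X ⟶ Y}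
    (h : IsKernelPair f p q) {a : R} (h₁ : 0 ≤ p.hom' a) (h₂ : 0 ≤ q.hom' a) : 0 ≤ a := by
  obtain ⟨z, hz₁, hz₂, hz⟩ := exists_of_isPullback h
    (hom'_congr h.w a : f.hom' (p.hom' a) = f.hom' (q.hom' a))
  rw [← eq_of_jointlyMono ⟨fun _ _ _ => h.hom_ext⟩ hz₁ hz₂]
  exact hz h₁ h₂

/-- A regular monomorphism reflects nonnegativity. -/
lemma nonneg_of_isRegularMono {j : X ⟶ Y} (hj : IsRegularMono j) {a : X}
    (ha : 0 ≤ j.hom' a) : 0 ≤ a := by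
  obtain ⟨⟨h⟩⟩ := hj
  have := h.mono
  -- The concrete equalizer has the induced order, so `k a` is nonnegative there, and the comparison
  -- `e` sends it back to `a`.
  let S := eqLocus h.left h.right
  let e : ofAddSubgroup Y S ⟶ X := Fork.IsLimit.lift h.isLimit (subtype Y S) (hom_ext fun s => s.2)
  have he : e ≫ j = subtype Y S := Fork.IsLimit.lift_ι' h.isLimit _ _
  let k : X ⟶ ofAddSubgroup Y S :=
    codRestrict j S fun x => hom'_congr h.w x
  have hk : k ≫ e = 𝟙 X := by
    rw [← cancel_mono j, Category.assoc, he]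
    rfl
  have := hom'_nonneg e (x := k.hom' a) ha
  rwa [← comp_hom'_apply, hk] at this

/-! ### Quotients and quotient maps -/

section Quotient

/-- The quotient by a normal subgroup; its positive cone is the image of the positive cone. -/
def quotient (X : ROrdGrp.{u}) (N : AddSubgroup X) [N.Normal] : ROrdGrp.{u} where
  carrier := X ⧸ N
  preorder :=
    { le := fun a b => ∃ x : X, 0 ≤ x ∧ (x : X ⧸ N) + a = b
      le_refl := fun a => ⟨0, le_rfl, by simp⟩
      le_trans := by
        rintro a _ _ ⟨x, hx, rfl⟩ ⟨y, hy, rfl⟩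
        -- Right translation alone gives `0 ≤ x ≤ y + x`.
        exact ⟨y + x, hx.trans (le_add_of_nonneg_left hy), by simp [add_assoc]⟩ }
  addRightMono := ⟨by
    rintro c a _ ⟨x, hx, rfl⟩
    exact ⟨x, hx, (add_assoc _ _ _).symm⟩⟩

variable (N : AddSubgroup X) [N.Normal]

lemma quotient_nonneg_iff {a : quotient X N} :
    0 ≤ a ↔ ∃ x : X, 0 ≤ x ∧ (QuotientAddGroup.mk' N x : X ⧸ N) = a := by
  refine exists_congr fun x => and_congr_right fun _ => ?_
  exact Eq.congr_left (add_zero (QuotientAddGroup.mk' N x : X ⧸ N))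

/-- The quotient morphism. -/
def quotientMk : X ⟶ quotient X N :=
  homMk (Y := quotient X N) (QuotientAddGroup.mk' N)
    fun x hx => (quotient_nonneg_iff N).2 ⟨x, hx, rfl⟩

lemma quotientMk_eq_iff {x y : X} :
    (quotientMk N).hom' x = (quotientMk N).hom' y ↔ -x + y ∈ N :=
  QuotientAddGroup.eq

lemma quotientMk_eq_zero_iff {x : X} : (quotientMk N).hom' x = 0 ↔ x ∈ N :=
  QuotientAddGroup.eq_zero_iff x

end Quotient

/-- A morphism is a quotient map if it is surjective and every nonnegative element lifts to a
nonnegative element. -/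
structure IsQuotientMap (f : X ⟶ Y) : Prop where
  surjective : Function.Surjective f.hom'
  exists_nonneg : ∀ y, 0 ≤ y → ∃ x, 0 ≤ x ∧ f.hom' x = y

lemma isQuotientMap_quotientMk (N : AddSubgroup X) [N.Normal] : IsQuotientMap (quotientMk N) where
  surjective := QuotientAddGroup.mk'_surjective N
  exists_nonneg _ hy := (quotient_nonneg_iff N).1 hy

namespace IsQuotientMap

variable {f : X ⟶ Y} (hf : IsQuotientMap f)
include hf

lemma epi : Epi f where
  left_cancellation g h w := hom_ext fun y => by
    obtain ⟨x, rfl⟩ := hf.surjective y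
    exact hom'_congr w x

/-- A morphism vanishing on the kernel of a quotient map factors through it. -/
lemma exists_desc (g : X ⟶ Z) (hg : ∀ x, f.hom' x = 0 → g.hom' x = 0) :
    ∃ d : Y ⟶ Z, f ≫ d = g := by
  have hd (x : X) : (f.hom' : X →+ Y).liftOfSurjective hf.surjective
      ⟨(g.hom' : X →+ Z), fun x hx => hg x hx⟩ (f.hom' x) = g.hom' x :=
    AddMonoidHom.liftOfRightInverse_comp_apply (f.hom' : X →+ Y) _ _ _ x
  refine ⟨homMk ((f.hom' : X →+ Y).liftOfSurjective hf.surjective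
    ⟨(g.hom' : X →+ Z), fun x hx => hg x hx⟩) fun y hy => ?_, hom_ext hd⟩
  obtain ⟨x, hx, rfl⟩ := hf.exists_nonneg y hy
  rw [hd]
  exact hom'_nonneg g hx

/-- A quotient map coequalizes any pair whose differences normally generate its kernel. -/
noncomputable def isColimitCofork {R : ROrdGrp.{u}} {p q : R ⟶ X} (w : p ≫ f = q ≫ f)
    (h : ∀ {Z : ROrdGrp.{u}} (g : X ⟶ Z), p ≫ g = q ≫ g → ∀ x, f.hom' x = 0 → g.hom' x = 0) :
    IsColimit (Cofork.ofπ f w) :=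
  Cofork.IsColimit.mk _ (fun s => (hf.exists_desc s.π (h s.π s.condition)).choose)
    (fun s => (hf.exists_desc s.π (h s.π s.condition)).choose_spec)
    (fun s m hm => by
      have := hf.epi
      rw [← cancel_epi f, (hf.exists_desc s.π (h s.π s.condition)).choose_spec]
      exact hm)

/-- A quotient map is the coequalizer of its kernel pair. -/
lemma isRegularEpi : IsRegularEpi f :=
  isRegularEpi_of_regularEpi
    { W := fibreProd f f
      left := fibreFst f f
      right := fibreSnd f f
      w := (isPullback_fibreProd f f).w
      isColimit := hf.isColimitCofork _ fun g hg x hx => by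
        let z : fibreProd f f := ⟨(x, 0), hx.trans (map_zero f.hom').symm⟩
        exact (hom'_congr hg z).trans (map_zero g.hom') }

/-- A quotient map is the cokernel of its kernel. -/
lemma nonempty_normalEpi : Nonempty (NormalEpi f) :=
  ⟨{  W := ofAddSubgroup X (eqLocus f 0)
      g := subtype X _
      w := hom_ext fun x => x.2
      isColimit := hf.isColimitCofork _ fun _ hg x hx =>
        hom'_congr (hg.trans zero_comp) (⟨x, hx⟩ : eqLocus f 0) }⟩

end IsQuotientMap

/-! ### Coequalizers and regular epimorphisms -/

section Coequalizer

variable {R : ROrdGrp.{u}} (p q : R ⟶ X)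

/-- The normal subgroup generated by the differences of two morphisms. -/
def differences : AddSubgroup X :=
  AddSubgroup.normalClosure (Set.range fun r => -p.hom' r + q.hom' r)

instance : (differences p q).Normal := AddSubgroup.normalClosure_normal

lemma comp_quotientMk_differences :
    p ≫ quotientMk (differences p q) = q ≫ quotientMk (differences p q) :=
  hom_ext fun r => (quotientMk_eq_iff _).2 (AddSubgroup.subset_normalClosure ⟨r, rfl⟩)

/-- The quotient by the differences is the coequalizer. -/
noncomputable def isColimitQuotientMkDifferences :
    IsColimit (Cofork.ofπ _ (comp_quotientMk_differences p q)) :=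
  (isQuotientMap_quotientMk _).isColimitCofork _ fun {Z} g hg x hx => by
    have hle : differences p q ≤ (g.hom' : X →+ Z).ker := by
      refine AddSubgroup.normalClosure_le_normal ?_
      rintro _ ⟨r, rfl⟩
      have : g.hom' (p.hom' r) = g.hom' (q.hom' r) := hom'_congr hg r
      simp [AddMonoidHom.mem_ker, this]
    exact hle ((quotientMk_eq_zero_iff _).1 hx)

instance : HasCoequalizer p q :=
  ⟨⟨_, isColimitQuotientMkDifferences p q⟩⟩

end Coequalizer

/-- Coequalizers are unique up to isomorphism, so lifts along the concrete quotient by the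
differences give lifts along `f`. -/
lemma IsQuotientMap.of_isRegularEpi {f : X ⟶ Y} (hf : IsRegularEpi f) : IsQuotientMap f := by
  obtain ⟨⟨h⟩⟩ := hf
  have := h.epi
  let N := differences h.left h.right
  obtain ⟨e, he⟩ : ∃ e : Y ⟶ quotient X N, f ≫ e = quotientMk N :=
    ⟨_, Cofork.IsColimit.π_desc' h.isColimit _ (comp_quotientMk_differences h.left h.right)⟩
  obtain ⟨d, hd⟩ : ∃ d : quotient X N ⟶ Y, quotientMk N ≫ d = f :=
    ⟨_, Cofork.IsColimit.π_desc' (isColimitQuotientMkDifferences h.left h.right) _ h.w⟩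
  have hed : e ≫ d = 𝟙 Y := by
    rw [← cancel_epi f, reassoc_of% he, hd, Category.comp_id]
  have hed' (y : Y) : d.hom' (e.hom' y) = y := hom'_congr hed y
  have hd' (x : X) : d.hom' ((quotientMk N).hom' x) = f.hom' x :=
    hom'_congr hd x
  constructor
  · intro y
    obtain ⟨x, hx⟩ := (isQuotientMap_quotientMk N).surjective (e.hom' y)
    exact ⟨x, by rw [← hd', hx, hed']⟩
  · intro y hy
    obtain ⟨x, hx, hxy⟩ := (isQuotientMap_quotientMk N).exists_nonneg _ (hom'_nonneg e hy)
    exact ⟨x, hx, by rw [← hd', hxy, hed']⟩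

/-- The regular epimorphisms are the quotient maps. -/
lemma isRegularEpi_iff {f : X ⟶ Y} : IsRegularEpi f ↔ IsQuotientMap f :=
  ⟨.of_isRegularEpi, fun h => h.isRegularEpi⟩

instance : Regular ROrdGrp.{u} where
  hasCoequalizer_of_isKernelPair _ := inferInstance
  regularEpiIsStableUnderBaseChange := ⟨fun {X Y Y' S f g f' g'} h hg => by
    rw [MorphismProperty.regularEpi_iff, isRegularEpi_iff] at hg ⊢
    constructor
    · intro y
      obtain ⟨x, hx⟩ := hg.surjective (f.hom' y)
      obtain ⟨z, -, hz, -⟩ := exists_of_isPullback h hx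
      exact ⟨z, hz⟩
    · intro y hy
      obtain ⟨x, hx, hxy⟩ := hg.exists_nonneg _ (hom'_nonneg f hy)
      obtain ⟨z, -, hz, hz'⟩ := exists_of_isPullback h hxy
      exact ⟨z, hz' hx hy, hz⟩⟩

instance : IsNormalCategory ROrdGrp.{u} where
  nonempty_normalEpi _ hf := (isRegularEpi_iff.1 hf).nonempty_normalEpi

/-! ### Reflexive relations and effectiveness -/

section Effective

variable {T : ROrdGrp.{u}} {p q : T ⟶ X}

/-- The class of zero for a reflexive relation. -/
def zeroClass (p q : T ⟶ X) : AddSubgroup X := (eqLocus q 0).map (p.hom' : T →+ X)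

lemma mem_zeroClass {x : X} : x ∈ zeroClass p q ↔ ∃ t, q.hom' t = 0 ∧ p.hom' t = x := Iff.rfl

variable (h : ReflexiveRelation p q)
include h

lemma hom'_reflexivity_left (x : X) : p.hom' (h.r.hom' x) = x :=
  hom'_congr h.reflexivity₁ x

lemma hom'_reflexivity_right (x : X) : q.hom' (h.r.hom' x) = x :=
  hom'_congr h.reflexivity₂ x

/-- Reflexivity puts the diagonal in `T`, so conjugation by `x` lifts to conjugation by `(x, x)`. -/
lemma zeroClass_normal : (zeroClass p q).Normal where
  conj_mem := by
    rintro _ ⟨t, ht, rfl⟩ x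
    replace ht : q.hom' t = 0 := ht
    exact mem_zeroClass.2 ⟨h.r.hom' x + t + -h.r.hom' x,
      by simp [ht, hom'_reflexivity_right h], by simp [hom'_reflexivity_left h]⟩

/-- Two elements are related by a reflexive relation if they agree modulo the class of zero. -/
lemma exists_of_neg_add_mem_zeroClass {x y : X} (hxy : -x + y ∈ zeroClass p q) :
    ∃ t, p.hom' t = x ∧ q.hom' t = y := by
  obtain ⟨t, ht, hxy⟩ := mem_zeroClass.1 hxy
  -- In pairs: `(y, y) - (-x + y, 0) = (x, y)`.
  exact ⟨h.r.hom' y + -t, by simp [hxy, hom'_reflexivity_left h],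
    by simp [ht, hom'_reflexivity_right h]⟩

lemma neg_add_mem_zeroClass (t : T) : -p.hom' t + q.hom' t ∈ zeroClass p q :=
  mem_zeroClass.2 ⟨-t + h.r.hom' (q.hom' t), by simp [hom'_reflexivity_right h],
    by simp [hom'_reflexivity_left h]⟩

/-- A reflexive relation with the preorder induced by its projections is the kernel pair of the
quotient by the class of zero. -/
lemma isKernelPair_of_reflexiveRelation [(zeroClass p q).Normal]
    (hT : ∀ t, 0 ≤ p.hom' t → 0 ≤ q.hom' t → 0 ≤ t) :
    IsKernelPair (quotientMk (zeroClass p q)) p q := by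
  have w : p ≫ quotientMk (zeroClass p q) = q ≫ quotientMk (zeroClass p q) :=
    hom_ext fun t => (quotientMk_eq_iff _).2 (neg_add_mem_zeroClass h t)
  have hlift {Z : ROrdGrp.{u}} (a b : Z ⟶ X)
      (hab : a ≫ quotientMk (zeroClass p q) = b ≫ quotientMk (zeroClass p q)) :
      ∃ l : Z ⟶ T, l ≫ p = a ∧ l ≫ q = b := by
    -- The lift is chosen pointwise; joint injectivity makes it additive, and `hT` makes it
    -- monotone.
    choose l hl₁ hl₂ using fun z : Z => exists_of_neg_add_mem_zeroClass h
      ((quotientMk_eq_iff _).1 (hom'_congr hab z : (quotientMk _).hom' (a.hom' z) =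
        (quotientMk _).hom' (b.hom' z)))
    refine ⟨homMk (AddMonoidHom.mk' l fun y z => eq_of_jointlyMono h.toJointlyMono₂
      (by simp [hl₁]) (by simp [hl₂])) fun z hz => hT _ ?_ ?_, hom_ext hl₁, hom_ext hl₂⟩
    · exact (hl₁ z).symm ▸ hom'_nonneg a hz
    · exact (hl₂ z).symm ▸ hom'_nonneg b hz
  exact ⟨⟨w⟩, ⟨PullbackCone.IsLimit.mk w
    (fun s => (hlift s.fst s.snd s.condition).choose)
    (fun s => (hlift s.fst s.snd s.condition).choose_spec.1)
    (fun s => (hlift s.fst s.snd s.condition).choose_spec.2)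
    (fun s m h₁ h₂ => h.right_cancellation _ _
      (h₁.trans (hlift s.fst s.snd s.condition).choose_spec.1.symm)
      (h₂.trans (hlift s.fst s.snd s.condition).choose_spec.2.symm))⟩⟩

/-- The quotient by the class of zero is the pushout of a reflexive relation. -/
lemma isPushout_of_reflexiveRelation [(zeroClass p q).Normal] :
    IsPushout p q (quotientMk (zeroClass p q)) (quotientMk (zeroClass p q)) := by
  have w : p ≫ quotientMk (zeroClass p q) = q ≫ quotientMk (zeroClass p q) :=
    hom_ext fun t => (quotientMk_eq_iff _).2 (neg_add_mem_zeroClass h t)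
  have hdesc (s : PushoutCocone p q) :
      ∃ d, quotientMk (zeroClass p q) ≫ d = s.inl ∧ quotientMk (zeroClass p q) ≫ d = s.inr := by
    -- The common section of `p` and `q` forces the legs of any cocone to agree, so the pushout is
    -- the coequalizer.
    have hs : s.inl = s.inr := by
      rw [← Category.id_comp s.inl, ← h.reflexivity₁, Category.assoc, s.condition,
        ReflexiveRelation.reflexivity₂_assoc]
    obtain ⟨d, hd⟩ := (isQuotientMap_quotientMk (zeroClass p q)).exists_desc s.inl fun x hx => by
      obtain ⟨t, ht, rfl⟩ := mem_zeroClass.1 ((quotientMk_eq_zero_iff _).1 hx)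
      have := hom'_congr s.condition t
      exact this.trans ((congrArg s.inr.hom' ht).trans (map_zero _))
    exact ⟨d, hd, hd.trans hs⟩
  have := (isQuotientMap_quotientMk (zeroClass p q)).epi
  exact ⟨⟨w⟩, ⟨PushoutCocone.IsColimit.mk w (fun s => (hdesc s).choose)
    (fun s => (hdesc s).choose_spec.1) (fun s => (hdesc s).choose_spec.2)
    (fun s m h₁ _ => by
      rw [← cancel_epi (quotientMk (zeroClass p q)), h₁, (hdesc s).choose_spec.1])⟩⟩

end Effective

instance : IsEfficientlyRegular ROrdGrp.{u} where
  isEffective t₁ t₂ r₁ r₂ j := by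
    rintro ⟨⟨h⟩⟩ ⟨⟨k⟩⟩ rfl rfl hj
    have := zeroClass_normal h.toReflexiveRelation
    exact ⟨⟨{ h with
      B := _
      π := quotientMk (zeroClass (j ≫ r₁) (j ≫ r₂))
      isKernelPair := isKernelPair_of_reflexiveRelation h.toReflexiveRelation fun t h₁ h₂ =>
        nonneg_of_isRegularMono hj (nonneg_of_isKernelPair k.isKernelPair h₁ h₂)
      isPushout := isPushout_of_reflexiveRelation h.toReflexiveRelation }⟩⟩

/-! ### An equivalence relation that is not effective -/

section Counterexample

/-- The full relation on `X`, with positive cone the diagonal of the positive cone of `X`. -/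
def diagonalOrder (X : ROrdGrp.{u}) : ROrdGrp.{u} where
  carrier := X × X
  preorder :=
    { le := fun a b => a.1 ≤ b.1 ∧ b.1 - a.1 = b.2 - a.2
      lt := fun a b => (a.1 ≤ b.1 ∧ b.1 - a.1 = b.2 - a.2) ∧ ¬(b.1 ≤ a.1 ∧ a.1 - b.1 = a.2 - b.2)
      le_refl := fun a => ⟨le_rfl, by simp⟩
      le_trans := fun a b c h h' => ⟨h.1.trans h'.1, by
        rw [← sub_add_sub_cancel c.1 b.1, ← sub_add_sub_cancel c.2 b.2, h.2, h'.2]⟩ }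
  addRightMono := ⟨fun c a b h => ⟨add_le_add_left h.1 c.1, by
    simpa only [Prod.fst_add, Prod.snd_add, add_sub_add_right_eq_sub] using h.2⟩⟩

lemma diagonalOrder_nonneg_iff {a : diagonalOrder X} : 0 ≤ a ↔ 0 ≤ a.1 ∧ a.1 = a.2 := by
  change (0 : X) ≤ a.1 ∧ a.1 - 0 = a.2 - 0 ↔ _
  simp only [sub_zero]

/-- The first projection. -/
def diagonalFst (X : ROrdGrp.{u}) : diagonalOrder X ⟶ X :=
  homMk (X := diagonalOrder X) (AddMonoidHom.fst X X) fun _ h => (diagonalOrder_nonneg_iff.1 h).1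

/-- The second projection. -/
def diagonalSnd (X : ROrdGrp.{u}) : diagonalOrder X ⟶ X :=
  homMk (X := diagonalOrder X) (AddMonoidHom.snd X X) fun _ h =>
    have h := diagonalOrder_nonneg_iff.1 h
    h.1.trans_eq h.2

/-- The composition of composable pairs. -/
def diagonalTrans (X : ROrdGrp.{u}) :
    fibreProd (diagonalSnd X) (diagonalFst X) ⟶ diagonalOrder X :=
  let a : fibreProd (diagonalSnd X) (diagonalFst X) →+o X :=
    (fibreFst (diagonalSnd X) (diagonalFst X) ≫ diagonalFst X).hom'
  let b : fibreProd (diagonalSnd X) (diagonalFst X) →+o X :=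
    (fibreSnd (diagonalSnd X) (diagonalFst X) ≫ diagonalSnd X).hom'
  homMk (Y := diagonalOrder X) (a.toAddMonoidHom.prod b.toAddMonoidHom) fun z h => by
    have h₁ := diagonalOrder_nonneg_iff.1 (hom'_nonneg (fibreFst _ _) h)
    have h₂ := diagonalOrder_nonneg_iff.1 (hom'_nonneg (fibreSnd _ _) h)
    exact diagonalOrder_nonneg_iff.2 ⟨h₁.1, h₁.2.trans (Eq.trans z.2 h₂.2)⟩

/-- The full relation with the diagonal order is an equivalence relation. -/
noncomputable def diagonalEquivalenceRelation (X : ROrdGrp.{u}) :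
    EquivalenceRelation (diagonalFst X) (diagonalSnd X) where
  right_cancellation _ _ _ h₁ h₂ := hom_ext fun z => Prod.ext
    (hom'_congr h₁ z) (hom'_congr h₂ z)
  r := homMk (Y := diagonalOrder X) ((AddMonoidHom.id X).prod (AddMonoidHom.id X))
    fun _ h => diagonalOrder_nonneg_iff.2 ⟨h, rfl⟩
  reflexivity₁ := rfl
  reflexivity₂ := rfl
  s := homMk (X := diagonalOrder X) (Y := diagonalOrder X)
    ((AddMonoidHom.snd X X).prod (AddMonoidHom.fst X X)) fun _ h =>
      have h := diagonalOrder_nonneg_iff.1 h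
      diagonalOrder_nonneg_iff.2 ⟨h.1.trans_eq h.2, h.2.symm⟩
  symmetry₁ := rfl
  symmetry₂ := rfl
  c := (isPullback_fibreProd (diagonalSnd X) (diagonalFst X)).cone
  isLimit := (isPullback_fibreProd (diagonalSnd X) (diagonalFst X)).isLimit
  t := diagonalTrans X
  transitivity₁ := rfl
  transitivity₂ := rfl

/-- If the full relation with the diagonal order is a kernel pair, then zero is the only
nonnegative element. -/
lemma eq_zero_of_isKernelPair_diagonal {f : X ⟶ Y}
    (h : IsKernelPair f (diagonalFst X) (diagonalSnd X)) {x : X} (hx : 0 ≤ x) : x = 0 := by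
  -- The relation is full, so `(x, 0)` lies in it; in a kernel pair it would be nonnegative, hence
  -- diagonal.
  obtain ⟨z, hz₁, hz₂, hz⟩ := exists_of_isPullback h
    (hom'_congr h.w (x, 0) : f.hom' x = f.hom' 0)
  exact hz₁.symm.trans ((diagonalOrder_nonneg_iff.1 (hz hx le_rfl)).2.trans hz₂)

/-- The ordered group of integers. -/
noncomputable def integers : ROrdGrp.{u} where
  carrier := ULift ℤ
  addRightMono := ⟨fun c _ _ h => add_le_add_left (α := ℤ) h c.down⟩

lemma not_isBarrExact : ¬ IsBarrExact ROrdGrp.{u} := fun h => by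
  obtain ⟨⟨e⟩⟩ := h.isEffective _ _ (diagonalEquivalenceRelation integers).isEquivalenceRelation
  have h01 : (0 : integers.{u}) ≤ (⟨1⟩ : ULift ℤ) := (zero_le_one : (0 : ℤ) ≤ 1)
  exact one_ne_zero (congrArg ULift.down (eq_zero_of_isKernelPair_diagonal e.isKernelPair h01))

end Counterexample

end ROrdGrp

theorem proposition2p6 :
    Regular ROrdGrp.{u} ∧ IsNormalCategory ROrdGrp.{u} ∧
      IsEfficientlyRegular ROrdGrp.{u} ∧ ¬ IsBarrExact ROrdGrp.{u} :=
  ⟨inferInstance, inferInstance, inferInstance, ROrdGrp.not_isBarrExact⟩
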